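/- Let $X$ be an infinite-dimensional real Banach space that is both uniformly rotund and uniformly smooth, i.e. for every $\varepsilon>0$ there is $\delta>0$ such that $\|x+y\|\le 2-\delta$ whenever $\|x\|=\|y\|=1$ and $\|x-y\|\ge\varepsilon$, and for every $\varepsilon>0$ there is $\delta>0$ such that $\|x+y\|+\|x-y\|\le 2+\varepsilon\|y\|$ whenever $\|x\|=1$ and $\|y\|\le\delta$. A family $\mathcal B$ of subsets of $X$ is called a covering of $X$ if $\bigcup\mathcal B=X$, and it is called point-finite if each $x\in X$ belongs to at most finitely many members of $\mathcal B$. Let $\mathrm{dens}(X)$ denote the smallest cardinality of a dense subset of $X$. Then the following assertions hold. (i) If $\mathrm{dens}(X)<2^{\aleph_0}$, then $X$ admits no point-finite covering whose members are open or closed balls of positive radius (open and closed balls may both occur in the same covering, and the radii may vary). (ii) If $\mathcal B$ is a covering of $X$ by open balls of positive radius (with no assumption on $\mathrm{dens}(X)$), then $\mathcal B$ is not point-finite. -/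

import Mathlib

open scoped Cardinal

universe u

/-- A real normed space is uniformly smooth if for every `ε > 0` there is `δ > 0` such that
`‖x + y‖ + ‖x - y‖ ≤ 2 + ε ‖y‖` for all `x` with `‖x‖ = 1` and all `y` with `‖y‖ ≤ δ`. Equivalently,
its modulus of smoothness `ρ` satisfies `ρ(τ) / τ → 0` as `τ → 0⁺`. -/
def UniformlySmooth (X : Type u) [NormedAddCommGroup X] : Prop :=
  ∀ ε : ℝ, 0 < ε → ∃ δ : ℝ, 0 < δ ∧
    ∀ x y : X, ‖x‖ = 1 → ‖y‖ ≤ δ → ‖x + y‖ + ‖x - y‖ ≤ 2 + ε * ‖y‖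

/-- The density character: the smallest cardinality of a dense subset. -/
noncomputable def densityCharacter (T : Type u) [TopologicalSpace T] : Cardinal.{u} :=
  sInf {κ : Cardinal.{u} | ∃ D : Set T, Dense D ∧ #D = κ}

/-- A family of subsets is a covering if the union of its members is the whole space. -/
def IsCovering {X : Type u} (F : Set (Set X)) : Prop :=
  ⋃₀ F = Set.univ

/-- A family of subsets is point-finite if each point lies in at most finitely many members. -/
def IsPointFinite {X : Type u} (F : Set (Set X)) : Prop :=
  ∀ x : X, {A ∈ F | x ∈ A}.Finite

/-- `A` is an open ball (of positive radius). -/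
def IsOpenBall {X : Type u} [NormedAddCommGroup X] (A : Set X) : Prop :=
  ∃ (c : X) (r : ℝ), 0 < r ∧ A = Metric.ball c r

/-- `A` is a closed ball of positive radius. -/
def IsClosedBallOfPosRadius {X : Type u} [NormedAddCommGroup X] (A : Set X) : Prop :=
  ∃ (c : X) (r : ℝ), 0 < r ∧ A = Metric.closedBall c r

/-! Take first a point-finite cover of an open set `U` by open balls. Shrinking and Zorn's lemma
replace the balls by closed convex sets `C i` with `C i` the closed convex hull of `V i`, the points
of `U` in no other member. Call a point of `U` singular if the `C i` are not locally finite there. A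
point of `U` in the closure of `V i` that is farthest in `V i` from some centre is singular.
Otherwise finitely many separating functionals matter near it, infinite dimension gives them a
common kernel vector `v`, and nearby points of `V i` can be moved along both `v` and `-v`, against
uniform convexity. Farthest points exist for a dense set of centres, and for remote centres they
almost maximise a functional, by smoothness. Hence caps of `C i` contain singular points
(`IsTightConvexCover.exists_mem_singularPoints`). So next to each singular point is another one,
inside a ball that omits the first. Iterating yields a point in infinitely many balls, hence there
are no singular points; yet one cap produces one (`not_pointFinite_ball_cover`). Assertion (ii) is
the case `U = X`. For (i) only the interiors of the balls need be point-finite. With countably many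
closed balls, Baire's theorem on the set missed by the interiors finds a piece of it inside one
closed ball, and a slight enlargement of that ball reduces to open balls. In general, pass to a
separable subspace containing the centre of every ball whose interior meets it. By strict convexity
each other ball meets it in at most one point, so fewer than continuum many points remain. They form
a Borel set, hence a countable one. -/

open Set Metric Filter Topology TopologicalSpace

/-! ### Uniform convexity: small caps, farthest points, contact points. -/

section UniformConvexity

variable {E : Type*} [NormedAddCommGroup E] [NormedSpace ℝ E]

/-- In a uniformly convex space, two vectors of a ball of radius at most `R` whose sum is almost as
long as possible are close to each other. -/
lemma exists_norm_sub_le_of_two_mul_sub_le_norm_add [UniformConvexSpace E] (R : ℝ) {η : ℝ}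
    (hη : 0 < η) :
    ∃ t, 0 < t ∧ ∀ D ≤ R, ∀ a b : E, ‖a‖ ≤ D → ‖b‖ ≤ D → 2 * D - t ≤ ‖a + b‖ → ‖a - b‖ ≤ η := by
  have hR : 0 < max R 1 := lt_of_lt_of_le one_pos (le_max_right _ _)
  obtain ⟨δ, hδ, h⟩ := exists_forall_closed_ball_dist_add_le_two_sub E (div_pos hη hR)
  -- If `‖a - b‖ > η` then `D > η / 2`, so after rescaling the convexity gain `δ * D` exceeds `δ * η
  -- / 2`, more than the allowed deficit.
  refine ⟨δ * η / 4, by positivity, fun D hD a b ha hb hab => ?_⟩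
  by_contra! hlt
  have hD2 : η / 2 < D := by linarith [norm_sub_le a b]
  have hD0 : 0 < D := by linarith
  have scale (x : E) : ‖D⁻¹ • x‖ = ‖x‖ / D := by
    rw [norm_smul, Real.norm_of_nonneg (by positivity)]; field_simp
  have key := @h (D⁻¹ • a) (by rw [scale, div_le_one hD0]; exact ha) (D⁻¹ • b)
    (by rw [scale, div_le_one hD0]; exact hb) (by
      rw [← smul_sub, scale]
      have : D ≤ max R 1 := hD.trans (le_max_left _ _)
      gcongr)
  rw [← smul_add, scale, div_le_iff₀ hD0] at key
  nlinarith

/-- In a uniformly convex space, a vector `a` of norm at most `r` with `‖a + t • e‖` almost equal to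
`r + t` is close to `r • e`. -/
lemma exists_norm_sub_smul_le_of_add_sub_le_norm [UniformConvexSpace E] {r t η : ℝ} (ht : 0 < t)
    (htr : t < r) (hη : 0 < η) :
    ∃ ε, 0 < ε ∧ ∀ a e : E, ‖a‖ ≤ r → ‖e‖ = 1 → r + t - ε ≤ ‖a + t • e‖ → ‖a - r • e‖ ≤ η := by
  have hr : 0 < r := ht.trans htr
  obtain ⟨δ, hδ, h⟩ := exists_norm_sub_le_of_two_mul_sub_le_norm_add (E := E) r hη
  refine ⟨δ * t / r, by positivity, fun a e ha he hae => h r le_rfl a (r • e) ha ?_ ?_⟩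
  · rw [norm_smul, he, mul_one, Real.norm_of_nonneg hr.le]
  -- Stretching by `r / t > 1` reduces to the sum `a + r • e`; the deficit `δ * t / r` becomes `δ`.
  · have h1 : (r / t) • (a + t • e) = (a + r • e) + (r / t - 1) • a := by
      rw [smul_add, smul_smul, div_mul_cancel₀ _ ht.ne', sub_smul, one_smul]; abel
    have h2 : ‖(r / t) • (a + t • e)‖ ≤ ‖a + r • e‖ + (r / t - 1) * r := by
      rw [h1]
      refine (norm_add_le _ _).trans ?_
      have : 0 ≤ r / t - 1 := by rw [sub_nonneg, one_le_div ht]; exact htr.le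
      rw [norm_smul, Real.norm_of_nonneg this]
      gcongr
    rw [norm_smul, Real.norm_of_nonneg (by positivity)] at h2
    have h3 : (r / t) * (r + t - δ * t / r) ≤ r / t * ‖a + t • e‖ := by gcongr
    have h4 : (r / t) * (r + t - δ * t / r) = (r / t - 1) * r + 2 * r - δ := by
      field_simp; ring
    linarith

/-- Small caps of balls: if `g` attains its norm in the direction `b`, where `‖b‖ = D ≤ R`, then the
points `a` of the ball of radius `D` with `g a` almost equal to `D` are close to `b`. -/
lemma exists_cap_subset [UniformConvexSpace E] (R : ℝ) {η : ℝ} (hη : 0 < η) :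
    ∃ t, 0 < t ∧ ∀ (g : StrongDual ℝ E) (a b : E), ‖g‖ ≤ 1 → ‖b‖ ≤ R → g b = ‖b‖ → ‖a‖ ≤ ‖b‖ →
      ‖b‖ - t ≤ g a → ‖a - b‖ ≤ η := by
  obtain ⟨t, ht, h⟩ := exists_norm_sub_le_of_two_mul_sub_le_norm_add (E := E) R hη
  refine ⟨t, ht, fun g a b hg hb hgb hab hga => h _ hb a b hab le_rfl ?_⟩
  have h1 : g (a + b) ≤ ‖a + b‖ :=
    (le_abs_self _).trans ((g.le_opNorm _).trans (mul_le_of_le_one_left (norm_nonneg _) hg))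
  rw [map_add, hgb] at h1
  linarith

/-- In a uniformly convex space, a nonempty bounded set has, for a dense set of points `p`, a
farthest point from `p` in its closure. -/
theorem exists_farthest_point [UniformConvexSpace E] [CompleteSpace E] {W : Set E}
    (hW : W.Nonempty) (hb : Bornology.IsBounded W) (p₀ : E) {γ : ℝ} (hγ : 0 < γ) :
    ∃ p, dist p p₀ < γ ∧ ∃ y ∈ closure W, ∀ w ∈ W, dist w p ≤ dist y p := by
  -- `G n` holds the centres whose almost farthest points in `W` all lie in one ball of radius `1 /
  -- (n + 1)`. For a centre in every `G n`, maximising sequences are Cauchy.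
  let G : ℕ → Set E := fun n => {p | ∃ s : ℝ, (∃ w ∈ W, s < dist w p) ∧
    ∃ z, ∀ w ∈ W, s < dist w p → dist w z ≤ 1 / ((n : ℝ) + 1)}
  have bdd (p : E) : BddAbove ((fun w => dist w p) '' W) := by
    obtain ⟨M, hM⟩ := hb.subset_closedBall p
    exact ⟨M, by rintro _ ⟨w, hw, rfl⟩; exact hM hw⟩
  have hopen (n) : IsOpen (G n) := by
    rw [Metric.isOpen_iff]
    rintro p ⟨s, ⟨w₀, hw₀, hs⟩, z, hz⟩
    refine ⟨(dist w₀ p - s) / 2, by linarith, fun p' hp' => ?_⟩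
    rw [mem_ball] at hp'
    refine ⟨s + (dist w₀ p - s) / 2, ⟨w₀, hw₀, ?_⟩, z, fun w hw hws => hz w hw ?_⟩
    · linarith [dist_triangle w₀ p' p]
    · linarith [dist_triangle_right w p' p, dist_comm p p']
  have hdense (n) : Dense (G n) := by
    rw [Metric.dense_iff]
    intro p t ht
    have hη : (0 : ℝ) < 1 / ((n : ℝ) + 1) := by positivity
    set r := sSup ((fun w => dist w p) '' W) with hr
    have hle (w) (hw : w ∈ W) : dist w p ≤ r := le_csSup (bdd p) ⟨w, hw, rfl⟩
    rcases le_or_gt r 0 with h0 | h0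
    · obtain ⟨w₀, hw₀⟩ := hW
      refine ⟨p, mem_ball_self ht, -1, ⟨w₀, hw₀, by linarith [dist_nonneg (x := w₀) (y := p)]⟩, p,
        fun w hw _ => ((hle w hw).trans h0).trans hη.le⟩
    obtain ⟨t', ht', ht'r, ht't⟩ : ∃ t', 0 < t' ∧ t' < r ∧ t' < t :=
      ⟨min r t / 2, by positivity, by linarith [min_le_left r t], by linarith [min_le_right r t]⟩
    obtain ⟨ε, hε, h⟩ := exists_norm_sub_smul_le_of_add_sub_le_norm (E := E) ht' ht'r hη
    obtain ⟨_, ⟨z, hzW, rfl⟩, hz⟩ : ∃ d ∈ (fun w => dist w p) '' W, max 0 (r - ε / 2) < d :=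
      exists_lt_of_lt_csSup (hW.image _) (by rw [← hr]; exact max_lt h0 (by linarith))
    have hz0 : 0 < ‖z - p‖ := by rw [← dist_eq_norm]; exact (le_max_left _ _).trans_lt hz
    have hz1 : r - ε / 2 < ‖z - p‖ := by rw [← dist_eq_norm]; exact (le_max_right _ _).trans_lt hz
    set e := ‖z - p‖⁻¹ • (z - p) with he
    have hen : ‖e‖ = 1 := by
      rw [he, norm_smul, norm_inv, norm_norm, inv_mul_cancel₀ hz0.ne']
    have hze : z - p = ‖z - p‖ • e := by
      rw [he, smul_smul, mul_inv_cancel₀ hz0.ne', one_smul]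
    have hsub (w : E) : w - (p - t' • e) = (w - p) + t' • e := by abel
    -- The centre is moved away from the almost farthest point `z`. Points almost farthest from the
    -- new centre must nearly align with `e`, hence lie near `p + r • e`.
    refine ⟨p - t' • e, ?_, r + t' - ε, ⟨z, hzW, ?_⟩, p + r • e, fun w hw hws => ?_⟩
    · rw [mem_ball, dist_eq_norm, sub_sub_cancel_left, norm_neg, norm_smul, hen, mul_one,
        Real.norm_of_nonneg ht'.le]
      exact ht't
    · rw [dist_eq_norm, hsub, hze, ← add_smul, norm_smul, hen, mul_one,
        Real.norm_of_nonneg (by positivity)]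
      linarith
    · rw [dist_eq_norm, hsub] at hws
      rw [dist_eq_norm, ← sub_sub]
      exact h _ _ (by rw [← dist_eq_norm]; exact hle w hw) hen hws.le
  obtain ⟨p, hpγ, hp⟩ := (Metric.dense_iff.1 (dense_iInter_of_isOpen_nat hopen hdense)) p₀ γ hγ
  rw [mem_iInter] at hp
  refine ⟨p, hpγ, ?_⟩
  set r := sSup ((fun w => dist w p) '' W) with hr
  have hle (w) (hw : w ∈ W) : dist w p ≤ r := le_csSup (bdd p) ⟨w, hw, rfl⟩
  have hex (k : ℕ) : ∃ v ∈ W, r - 1 / ((k : ℝ) + 1) < dist v p := by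
    obtain ⟨_, ⟨v, hv, rfl⟩, h⟩ := exists_lt_of_lt_csSup (hW.image fun w => dist w p)
      (show r - 1 / ((k : ℝ) + 1) < r by linarith [show (0 : ℝ) < 1 / ((k : ℝ) + 1) by positivity])
    exact ⟨v, hv, h⟩
  choose v hvW hv using hex
  have hlim : Tendsto (fun k => dist (v k) p) atTop (𝓝 r) := by
    refine tendsto_of_tendsto_of_tendsto_of_le_of_le ?_ tendsto_const_nhds (fun k => (hv k).le)
      fun k => hle _ (hvW k)
    simpa using (tendsto_const_nhds (x := r)).sub tendsto_one_div_add_atTop_nhds_zero_nat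
  have hc : CauchySeq v := by
    rw [Metric.cauchySeq_iff']
    intro ε hε
    obtain ⟨n, hn⟩ := exists_nat_one_div_lt (half_pos hε)
    obtain ⟨s, ⟨w, hw, hsw⟩, z, hz⟩ := hp n
    obtain ⟨N, hN⟩ := eventually_atTop.1 (hlim.eventually (lt_mem_nhds (hsw.trans_le (hle w hw))))
    refine ⟨N, fun k hk => ?_⟩
    have h1 := hz _ (hvW k) (hN k hk)
    have h2 := hz _ (hvW N) (hN N le_rfl)
    linarith [dist_triangle_right (v k) (v N) z]
  obtain ⟨y, hy⟩ := cauchySeq_tendsto_of_complete hc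
  refine ⟨y, mem_closure_of_tendsto hy (Eventually.of_forall hvW), fun w hw => ?_⟩
  rw [tendsto_nhds_unique (hy.dist tendsto_const_nhds) hlim]
  exact hle w hw

/-- The point of contact of a closed ball with a supporting hyperplane lies in the closure of every
subset of the ball whose closed convex hull contains it. -/
lemma mem_closure_of_mem_closedConvexHull [UniformConvexSpace E] {F : Set E} {c : E} {r : ℝ}
    (hF : F ⊆ closedBall c r) {y : E} (hy : y ∈ closedConvexHull ℝ F) (hyr : r ≤ dist y c) :
    y ∈ closure F := by
  obtain ⟨g, hg, hgy'⟩ := exists_dual_vector'' ℝ (y - c)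
  have hgy : g (y - c) = ‖y - c‖ := by simpa using hgy'
  rw [Metric.mem_closure_iff]
  intro ε hε
  obtain ⟨t, ht, h⟩ := exists_cap_subset (E := E) ‖y - c‖ (half_pos hε)
  by_contra! hcon
  -- If `F` stays away from `y` it misses a whole cap at `y`, so a half-space excluding `y` contains
  -- `F` and its closed convex hull.
  have : closedConvexHull ℝ F ⊆ {w | g w ≤ g y - t} := by
    refine closedConvexHull_min (fun w hw => ?_) ?_ ?_
    · by_contra hlt
      rw [mem_ofPred_eq, not_le] at hlt
      have := h g (w - c) (y - c) hg le_rfl hgy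
        (by rw [← dist_eq_norm, ← dist_eq_norm]; exact (hF hw).trans hyr)
        (by rw [← hgy, map_sub, map_sub]; linarith)
      rw [sub_sub_sub_cancel_right] at this
      have h2 := hcon w hw
      rw [dist_comm, dist_eq_norm] at h2
      linarith
    · exact convex_halfSpace_le g.toLinearMap.isLinear _
    · exact isClosed_le g.continuous continuous_const
  have := this hy
  rw [mem_ofPred_eq] at this
  linarith

end UniformConvexity

/-! ### Uniform smoothness: large balls as approximate half-spaces. -/

section UniformSmoothness

/-- Balls of large radius in a uniformly smooth space are close to half-spaces. -/
lemma UniformlySmooth.exists_norm_smul_add_le {E : Type u} [NormedAddCommGroup E] [NormedSpace ℝ E]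
    (h : UniformlySmooth E) {ε : ℝ} (hε : 0 < ε) :
    ∃ δ, 0 < δ ∧ ∀ (g : StrongDual ℝ E) (e w : E) (D : ℝ), ‖g‖ ≤ 1 → ‖e‖ = 1 → g e = 1 → 0 < D →
      ‖w‖ ≤ δ * D → ‖D • e + w‖ ≤ D + g w + ε * ‖w‖ := by
  obtain ⟨δ, hδ, hsm⟩ := h ε hε
  refine ⟨δ, hδ, fun g e w D hg he hge hD hw => ?_⟩
  have hn : ‖D⁻¹ • w‖ = ‖w‖ / D := by
    rw [norm_smul, Real.norm_of_nonneg (by positivity)]; field_simp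
  have h1 := hsm e (D⁻¹ • w) he (by rw [hn, div_le_iff₀ hD]; exact hw)
  -- Bounding the second norm of the smoothness inequality below by `1 - g w / D` leaves an upper
  -- bound for the first.
  have h2 : g (e - D⁻¹ • w) ≤ ‖e - D⁻¹ • w‖ :=
    (le_abs_self _).trans ((g.le_opNorm _).trans (mul_le_of_le_one_left (norm_nonneg _) hg))
  rw [map_sub, hge, map_smul, smul_eq_mul] at h2
  have h3 : D • e + w = D • (e + D⁻¹ • w) := by
    rw [smul_add, smul_smul, mul_inv_cancel₀ hD.ne', one_smul]
  rw [h3, norm_smul, Real.norm_of_nonneg hD.le]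
  rw [hn] at h1
  have h4 : ‖e + D⁻¹ • w‖ ≤ 1 + D⁻¹ * g w + ε * (‖w‖ / D) := by linarith
  calc D * ‖e + D⁻¹ • w‖ ≤ D * (1 + D⁻¹ * g w + ε * (‖w‖ / D)) := by gcongr
    _ = D + g w + ε * ‖w‖ := by field_simp

end UniformSmoothness

/-- Finitely many linear functionals on an infinite-dimensional space have a common nonzero zero. -/
lemma exists_ne_zero_forall_eq_zero {E : Type*} [AddCommGroup E] [Module ℝ E]
    (hinf : ¬ FiniteDimensional ℝ E) {ι : Type*} {s : Set ι} (hs : s.Finite) (f : ι → E →ₗ[ℝ] ℝ) :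
    ∃ v, v ≠ 0 ∧ ∀ i ∈ s, f i v = 0 := by
  by_contra! hcon
  have := hs.to_subtype
  refine hinf (FiniteDimensional.of_injective (LinearMap.pi fun i : s => f i) ?_)
  rw [← LinearMap.ker_eq_bot, LinearMap.ker_eq_bot']
  intro v hv
  by_contra hv0
  obtain ⟨i, hi, hne⟩ := hcon v hv0
  exact hne (congrFun hv ⟨i, hi⟩)

/-! ### Minimal covers by closed convex sets. -/

section MinimalCover

variable {E : Type*} [NormedAddCommGroup E] [NormedSpace ℝ E] {ι : Type*}

/-- A family of convex sets covering `U`, each being the closed convex hull of the points of `U`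
that it alone covers. -/
structure IsTightConvexCover (U : Set E) (C : ι → Set E) : Prop where
  cover : U ⊆ ⋃ i, C i
  hull : ∀ i, C i = closedConvexHull ℝ (U \ ⋃ j ≠ i, C j)

/-- The points of `U` at which the family `C` fails to be locally finite. -/
def singularPoints (U : Set E) (C : ι → Set E) : Set E :=
  {y ∈ U | ∀ t > 0, {i | (C i ∩ ball y t).Nonempty}.Infinite}

/-- A cover by closed convex sets that is point-finite on `U` can be shrunk to a tight one. -/
lemma exists_isTightConvexCover {U : Set E} {D : ι → Set E} (hconv : ∀ i, Convex ℝ (D i))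
    (hcl : ∀ i, IsClosed (D i)) (hcov : U ⊆ ⋃ i, D i) (hfin : ∀ x ∈ U, {i | x ∈ D i}.Finite) :
    ∃ C : ι → Set E, IsTightConvexCover U C ∧ ∀ i, C i ⊆ D i := by
  classical
  let S : Set (ι → Set E) :=
    {C | (∀ i, Convex ℝ (C i)) ∧ (∀ i, IsClosed (C i)) ∧ U ⊆ (⋃ i, C i) ∧ ∀ i, C i ⊆ D i}
  have hD : D ∈ S := ⟨hconv, hcl, hcov, fun _ => Subset.rfl⟩
  have hchain : ∀ c ⊆ S, IsChain (fun A B : ι → Set E => A ≤ B) c → ∀ C₀ ∈ c,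
      ∃ lb ∈ S, ∀ B ∈ c, lb ≤ B := by
    intro c hcS hc C₀ hC₀
    refine ⟨fun i => ⋂ C ∈ c, C i, ⟨fun i => ?_, fun i => ?_, fun x hx => ?_, fun i => ?_⟩, ?_⟩
    · exact convex_iInter₂ fun C hC => (hcS hC).1 i
    · exact isClosed_biInter fun C hC => (hcS hC).2.1 i
    -- Only finitely many `D i` contain `x`. If each index lost `x` somewhere along the chain, one
    -- member of the chain would have lost `x` for all of these indices and would not cover it.
    · by_contra hcon
      have hcon' (i) : ∃ C ∈ c, x ∉ C i := by
        by_contra! h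
        exact hcon (mem_iUnion.2 ⟨i, mem_iInter₂.2 h⟩)
      choose A hAc hA using hcon'
      have key (s : Set ι) (hs : s.Finite) : ∃ B ∈ c, ∀ i ∈ s, B ≤ A i := by
        induction s, hs using Set.Finite.induction_on with
        | empty => exact ⟨C₀, hC₀, by simp⟩
        | @insert a s _ _ ih =>
          obtain ⟨B, hB, hBs⟩ := ih
          rcases hc.total hB (hAc a) with h | h
          · refine ⟨B, hB, fun i hi => ?_⟩
            rcases hi with rfl | hi
            exacts [h, hBs i hi]
          · refine ⟨A a, hAc a, fun i hi => ?_⟩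
            rcases hi with rfl | hi
            exacts [le_rfl, h.trans (hBs i hi)]
      obtain ⟨B, hB, hBA⟩ := key _ (hfin x hx)
      obtain ⟨i, hi⟩ := mem_iUnion.1 ((hcS hB).2.2.1 hx)
      exact hA i (hBA i ((hcS hB).2.2.2 i hi) i hi)
    · exact (biInter_subset_of_mem hC₀).trans ((hcS hC₀).2.2.2 i)
    · intro B hB i
      exact biInter_subset_of_mem hB
  obtain ⟨C, hC⟩ : ∃ C : ι → Set E, C ∈ S ∧ ∀ C' ∈ S, C' ≤ C → C ≤ C' := by
    obtain ⟨C, -, hC⟩ := @zorn_le_nonempty₀ (ι → Set E)ᵒᵈ _ S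
      (fun c hcS hc C₀ hC₀ => hchain c hcS hc.symm C₀ hC₀) D hD
    exact ⟨C, hC.1, fun C' hC' hle => hC.2 hC' hle⟩
  have hmem : C ∈ S := hC.1
  refine ⟨C, ⟨hmem.2.2.1, fun i => Subset.antisymm ?_ ?_⟩, hmem.2.2.2⟩
  · have hsub : closedConvexHull ℝ (U \ ⋃ j ≠ i, C j) ⊆ C i := by
      refine closedConvexHull_min (fun x hx => ?_) (hmem.1 i) (hmem.2.1 i)
      obtain ⟨j, hj⟩ := mem_iUnion.1 (hmem.2.2.1 hx.1)
      by_cases hji : j = i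
      · exact hji ▸ hj
      · exact absurd (mem_iUnion₂.2 ⟨j, hji, hj⟩) hx.2
    -- Shrinking the single set `C i` to this hull still covers `U`, so minimality forces equality.
    let C' := Function.update C i (closedConvexHull ℝ (U \ ⋃ j ≠ i, C j))
    have hself : C' i = closedConvexHull ℝ (U \ ⋃ j ≠ i, C j) := Function.update_self ..
    have hne (j) (hj : j ≠ i) : C' j = C j := Function.update_of_ne hj ..
    have hle : C' ≤ C := by
      intro j
      rcases eq_or_ne j i with rfl | hji
      · rw [hself]; exact hsub
      · rw [hne j hji]
    have hC' : C' ∈ S := by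
      refine ⟨fun j => ?_, fun j => ?_, fun x hx => ?_, fun j => (hle j).trans (hmem.2.2.2 j)⟩
      · rcases eq_or_ne j i with rfl | hji
        · rw [hself]; exact convex_closedConvexHull
        · rw [hne j hji]; exact hmem.1 j
      · rcases eq_or_ne j i with rfl | hji
        · rw [hself]; exact isClosed_closedConvexHull
        · rw [hne j hji]; exact hmem.2.1 j
      · by_cases hx' : x ∈ ⋃ j ≠ i, C j
        · obtain ⟨j, hji, hj⟩ := mem_iUnion₂.1 hx'
          exact mem_iUnion.2 ⟨j, by rw [hne j hji]; exact hj⟩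
        · exact mem_iUnion.2 ⟨i, by rw [hself]; exact subset_closedConvexHull ⟨hx, hx'⟩⟩
    have := hC.2 C' hC' hle i
    rwa [hself] at this
  · refine closedConvexHull_min (fun x hx => ?_) (hmem.1 i) (hmem.2.1 i)
    obtain ⟨j, hj⟩ := mem_iUnion.1 (hmem.2.2.1 hx.1)
    by_cases hji : j = i
    · exact hji ▸ hj
    · exact absurd (mem_iUnion₂.2 ⟨j, hji, hj⟩) hx.2

/-- A point-finite cover of an open set by open balls of a uniformly convex space can be shrunk to
a tight convex cover. -/
lemma exists_isTightConvexCover_of_ball [UniformConvexSpace E] {U : Set E}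
    {c : ι → E} {r : ι → ℝ} (hcov : U ⊆ ⋃ i, ball (c i) (r i))
    (hfin : ∀ x ∈ U, {i | x ∈ ball (c i) (r i)}.Finite) :
    ∃ C : ι → Set E, IsTightConvexCover U C ∧ (∀ i, C i ⊆ closedBall (c i) (r i)) ∧
      ∀ i, U ∩ C i ⊆ ball (c i) (r i) := by
  obtain ⟨v, hv, hvcl, hvB⟩ := exists_iUnion_eq_closed_subset
    (u := fun i => ((↑) : U → E) ⁻¹' ball (c i) (r i))
    (fun i => isOpen_ball.preimage continuous_subtype_val)
    (fun x => hfin x x.2)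
    (eq_univ_of_forall fun x => by simpa using hcov x.2)
  have hsub (i) : ((↑) : U → E) '' v i ⊆ closedBall (c i) (r i) := by
    rintro _ ⟨x, hx, rfl⟩
    exact ball_subset_closedBall (hvB i hx)
  -- A point of `U` in the hull but outside the open ball would be a contact point, hence in the
  -- closure of `v i`; but `v i` is closed in `U` and lies in the open ball.
  have hD (i) : U ∩ closedConvexHull ℝ (((↑) : U → E) '' v i) ⊆ ball (c i) (r i) := by
    rintro y ⟨hyU, hy⟩
    by_contra hlt
    rw [mem_ball, not_lt] at hlt
    have h1 := mem_closure_of_mem_closedConvexHull (hsub i) hy hlt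
    have h2 : (⟨y, hyU⟩ : U) ∈ v i := by
      rw [← (hvcl i).closure_eq, closure_subtype]
      exact h1
    exact absurd (hvB i h2) (by simpa using hlt)
  obtain ⟨C, hC, hCD⟩ := exists_isTightConvexCover (U := U)
    (D := fun i => closedConvexHull ℝ (((↑) : U → E) '' v i))
    (fun i => convex_closedConvexHull) (fun i => isClosed_closedConvexHull)
    (fun x hx => by
      have : (⟨x, hx⟩ : U) ∈ iUnion v := hv ▸ mem_univ _
      obtain ⟨i, hi⟩ := mem_iUnion.1 this
      exact mem_iUnion.2 ⟨i, subset_closedConvexHull ⟨_, hi, rfl⟩⟩)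
    (fun x hx => (hfin x hx).subset fun i hi => hD i ⟨hx, hi⟩)
  refine ⟨C, hC, fun i => (hCD i).trans ?_, fun i => ?_⟩
  · exact closedConvexHull_min (hsub i) (convex_closedBall _ _) isClosed_closedBall
  · exact (inter_subset_inter_right _ (hCD i)).trans (hD i)

end MinimalCover

/-! ### Singular points and the theorem for open balls. -/

section LocallyOpenCover

variable {E : Type u} [NormedAddCommGroup E] [NormedSpace ℝ E] {ι : Type*}

lemma StrongDual.apply_le_norm_of_norm_le_one {g : StrongDual ℝ E} (hg : ‖g‖ ≤ 1) (x : E) :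
    g x ≤ ‖x‖ :=
  (le_abs_self _).trans ((g.le_opNorm _).trans (mul_le_of_le_one_left (norm_nonneg _) hg))

lemma exists_dual_vector_real (x : E) : ∃ g : StrongDual ℝ E, ‖g‖ ≤ 1 ∧ g x = ‖x‖ := by
  obtain ⟨g, hg, h⟩ := exists_dual_vector'' ℝ x
  exact ⟨g, hg, by simpa using h⟩

lemma norm_inv_smul_self {x : E} (hx : 0 < ‖x‖) : ‖‖x‖⁻¹ • x‖ = 1 := by
  rw [norm_smul, norm_inv, norm_norm, inv_mul_cancel₀ hx.ne']

lemma IsTightConvexCover.convex {U : Set E} {C : ι → Set E} (hC : IsTightConvexCover U C) (i : ι) :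
    Convex ℝ (C i) := by
  rw [hC.hull]; exact convex_closedConvexHull

lemma IsTightConvexCover.isClosed {U : Set E} {C : ι → Set E} (hC : IsTightConvexCover U C)
    (i : ι) : IsClosed (C i) := by
  rw [hC.hull]; exact isClosed_closedConvexHull

lemma IsTightConvexCover.diff_subset {U : Set E} {C : ι → Set E} (hC : IsTightConvexCover U C)
    (i : ι) : U \ ⋃ j ≠ i, C j ⊆ C i := by
  conv_rhs => rw [hC.hull]
  exact subset_closedConvexHull

/-- A farthest point of the set of points of `U` covered by `C i` alone is singular. -/
lemma IsTightConvexCover.mem_singularPoints_of_farthest [UniformConvexSpace E]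
    (hinf : ¬ FiniteDimensional ℝ E) {U : Set E} (hU : IsOpen U) {C : ι → Set E}
    (hC : IsTightConvexCover U C) {i : ι} {p y : E} (hyU : y ∈ U)
    (hy : y ∈ closure (U \ ⋃ j ≠ i, C j))
    (hfar : ∀ w ∈ U \ ⋃ j ≠ i, C j, dist w p ≤ dist y p) : y ∈ singularPoints U C := by
  classical
  refine ⟨hyU, fun t ht hA => ?_⟩
  obtain ⟨t', ht', htU⟩ := Metric.isOpen_iff.1 hU y hyU
  obtain ⟨τ, hτ, hτt, hτt'⟩ : ∃ τ, 0 < τ ∧ τ ≤ t ∧ τ ≤ t' :=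
    ⟨min t t', lt_min ht ht', min_le_left _ _, min_le_right _ _⟩
  obtain ⟨δ, hδ, hδE⟩ := exists_forall_closed_ball_dist_add_le_two_mul_sub E hτ (dist y p)
  obtain ⟨z, hz, hzy⟩ := Metric.mem_closure_iff.1 hy (min (τ / 2) (δ / 2)) (by positivity)
  rw [dist_comm] at hzy
  have hzy1 := hzy.trans_le (min_le_left _ _)
  have hzy2 := hzy.trans_le (min_le_right _ _)
  have hsep (j : ι) : ∃ f : StrongDual ℝ E, j ≠ i → ∀ w ∈ C j, f z < f w := by
    by_cases hji : j = i
    · exact ⟨0, fun h => absurd hji h⟩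
    · obtain ⟨f, s, h1, h2⟩ := geometric_hahn_banach_point_closed (hC.convex j) (hC.isClosed j)
        (x := z) (fun h => hz.2 (mem_iUnion₂.2 ⟨j, hji, h⟩))
      exact ⟨f, fun _ w hw => h1.trans (h2 w hw)⟩
  choose f hf using hsep
  -- Moving `z` along `v` does not change the functionals separating it from the `C j` that meet
  -- `ball y t`, so `z` can move by `τ / 2` both ways without entering them.
  obtain ⟨v, hv0, hv⟩ := exists_ne_zero_forall_eq_zero hinf hA fun j => (f j).toLinearMap
  have hv0' : 0 < ‖v‖ := norm_pos_iff.2 hv0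
  set v' := (τ / 2) • (‖v‖⁻¹ • v) with hv'
  have hv'n : ‖v'‖ = τ / 2 := by
    rw [hv', norm_smul, norm_inv_smul_self hv0', mul_one, Real.norm_of_nonneg (by positivity)]
  have hmem (v'' : E) (hn : ‖v''‖ = τ / 2)
      (hker : ∀ j ∈ {j | (C j ∩ ball y t).Nonempty}, f j v'' = 0) :
      z + v'' ∈ U \ ⋃ j ≠ i, C j := by
    have hball : z + v'' ∈ ball y τ := by
      rw [mem_ball]
      have : dist (z + v'') z = τ / 2 := by rw [dist_eq_norm, add_sub_cancel_left, hn]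
      linarith [dist_triangle (z + v'') z y]
    refine ⟨htU (ball_subset_ball hτt' hball), fun hmem => ?_⟩
    obtain ⟨j, hji, hj⟩ := mem_iUnion₂.1 hmem
    have h1 := hf j hji _ hj
    rw [map_add, hker j ⟨_, hj, ball_subset_ball hτt hball⟩, add_zero] at h1
    exact lt_irrefl _ h1
  have hker : ∀ j ∈ {j | (C j ∩ ball y t).Nonempty}, f j v' = 0 := fun j hj => by
    have : f j v = 0 := hv j hj
    rw [hv', map_smul, map_smul, this, smul_zero, smul_zero]
  have h1 := hfar _ (hmem v' hv'n hker)
  have h2 := hfar _ (hmem (-v') (by rw [norm_neg, hv'n])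
    fun j hj => by rw [map_neg, hker j hj, neg_zero])
  rw [dist_eq_norm] at h1 h2
  -- The two points `z ± v'` are at least `τ` apart, so their midpoint `z` is closer to `p` than `y`
  -- is by at least `δ / 2`, contradicting `dist z y < δ / 2`.
  have h3 := hδE h1 h2 (by
    rw [show z + v' - p - (z + -v' - p) = (2 : ℝ) • v' by rw [two_smul]; abel, norm_smul, hv'n]
    norm_num; linarith)
  rw [show z + v' - p + (z + -v' - p) = (2 : ℝ) • (z - p) by rw [two_smul]; abel, norm_smul,
    Real.norm_of_nonneg zero_le_two, ← dist_eq_norm] at h3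
  linarith [dist_triangle_left y p z, dist_comm z y]

/-- If a member of a tight convex cover meets a half-space whose trace on the ball around this
member lies in `U`, then this member contains a singular point of that half-space. -/
lemma IsTightConvexCover.exists_mem_singularPoints [UniformConvexSpace E] [CompleteSpace E]
    (hsm : UniformlySmooth E) (hinf : ¬ FiniteDimensional ℝ E) {U : Set E} (hU : IsOpen U)
    {C : ι → Set E} (hC : IsTightConvexCover U C) {i : ι} {c : E} {r : ℝ}
    (hCi : C i ⊆ closedBall c r) {g : StrongDual ℝ E} {u q : E} {b : ℝ} (hg : ‖g‖ ≤ 1)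
    (hu : ‖u‖ = 1) (hgu : g u = 1) (hq : q ∈ C i) (hbq : b < g q)
    (hcap : ∀ w ∈ closedBall c r, b ≤ g w → w ∈ U) :
    ∃ y ∈ singularPoints U C, y ∈ C i ∧ b ≤ g y := by
  set V := U \ ⋃ j ≠ i, C j with hV
  have hVC : V ⊆ C i := hC.diff_subset i
  obtain ⟨w₀, hw₀, hbw₀⟩ : ∃ w ∈ V, b < g w := by
    by_contra! hcon
    have : C i ⊆ {w | g w ≤ b} := by
      rw [hC.hull]
      exact closedConvexHull_min hcon (convex_halfSpace_le g.toLinearMap.isLinear _)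
        (isClosed_le g.continuous continuous_const)
    exact absurd (this hq) (not_le.2 hbq)
  have hVb : Bornology.IsBounded V := isBounded_closedBall.subset (hVC.trans hCi)
  obtain ⟨M, hM, hVM⟩ := hVb.subset_closedBall_lt 0 0
  set s := g w₀ - b with hs
  have hs0 : 0 < s := sub_pos.2 hbw₀
  obtain ⟨δ, hδ, hδE⟩ := hsm.exists_norm_smul_add_le (show 0 < s / (4 * M) by positivity)
  -- This makes all of `closedBall 0 M` small on the scale `δ * L`, so there the distance to `-(L •
  -- u)` exceeds `L + g` by at most `s / 4`.
  set L := M / δ + 1 with hL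
  have hL0 : 0 < L := by positivity
  have hML : M ≤ δ * L := by
    rw [hL, mul_add, mul_div_cancel₀ _ hδ.ne']; linarith
  obtain ⟨p, hp, y, hy, hfar⟩ := exists_farthest_point ⟨w₀, hw₀⟩ hVb (-(L • u))
    (show 0 < s / 8 by positivity)
  have hyM : ‖y‖ ≤ M := by
    simpa using closure_minimal hVM isClosed_closedBall hy
  have hdist (w : E) : dist w (-(L • u)) = ‖L • u + w‖ := by
    rw [dist_eq_norm, sub_neg_eq_add, add_comm]
  have h1 : dist y (-(L • u)) ≤ L + g y + s / 4 := by
    rw [hdist]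
    refine (hδE g u y L hg hu hgu hL0 (hyM.trans hML)).trans ?_
    have : s / (4 * M) * ‖y‖ ≤ s / (4 * M) * M := by gcongr
    have h' : s / (4 * M) * M = s / 4 := by field_simp
    linarith
  have h2 : L + g w₀ ≤ dist w₀ (-(L • u)) := by
    rw [hdist]
    have := StrongDual.apply_le_norm_of_norm_le_one hg (L • u + w₀)
    rwa [map_add, map_smul, hgu, smul_eq_mul, mul_one] at this
  have h3 := hfar w₀ hw₀
  -- The losses are `s / 4` from smoothness and twice `s / 8` from moving the centre, together less
  -- than `s = g w₀ - b`.
  have hby : b ≤ g y := by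
    linarith [dist_triangle y (-(L • u)) p, dist_triangle w₀ p (-(L • u)),
      dist_triangle y p (-(L • u)), dist_triangle_right y p (-(L • u)), dist_comm p (-(L • u))]
  have hyC : y ∈ C i := closure_minimal hVC (hC.isClosed i) hy
  exact ⟨y, hC.mem_singularPoints_of_farthest hinf hU (hcap y (hCi hyC) hby) hy hfar, hyC, hby⟩

/-- In a uniformly smooth Banach space, balls with radii tending to infinity whose distances from
a point tend to zero are not point-finite near that point. -/
lemma UniformlySmooth.exists_infinite_mem_ball [CompleteSpace E] (hsm : UniformlySmooth E)
    {U : Set E} (hU : IsOpen U) {x : E} (hx : x ∈ U) {c : ι → E} {r : ι → ℝ}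
    (h : ∀ n : ℕ, ∃ i, (n : ℝ) < r i ∧ r i ≤ dist x (c i) ∧
      dist x (c i) < r i + 1 / ((n : ℝ) + 1)) :
    ∃ y ∈ U, {i | y ∈ ball (c i) (r i)}.Infinite := by
  choose i hir hid hid' using h
  choose g hg hgc using fun n => exists_dual_vector_real (c (i n) - x)
  have hD0 (n) : 0 < ‖c (i n) - x‖ := by
    rw [← dist_eq_norm, dist_comm]
    exact ((Nat.cast_nonneg n).trans_lt (hir n)).trans_le (hid n)
  set e : ℕ → E := fun n => ‖c (i n) - x‖⁻¹ • (c (i n) - x) with he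
  have hen (n) : ‖e n‖ = 1 := norm_inv_smul_self (hD0 n)
  have hge (n) : g n (e n) = 1 := by
    rw [he, map_smul, hgc, smul_eq_mul, inv_mul_cancel₀ (hD0 n).ne']
  have hce (n) : c (i n) - x = ‖c (i n) - x‖ • e n := by
    rw [he, smul_smul, mul_inv_cancel₀ (hD0 n).ne', one_smul]
  -- On bounded sets these balls eventually contain `x + {w | a ≤ g n w}`: the curvature error and
  -- the gap `1 / (n + 1)` are each below `a / 4`.
  have hfact (M a : ℝ) (ha : 0 < a) : ∀ᶠ n in atTop, ∀ w : E, ‖w‖ ≤ M → a ≤ g n w →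
      x + w ∈ ball (c (i n)) (r (i n)) := by
    have hM : 0 < max M 1 := lt_max_of_lt_right one_pos
    obtain ⟨δ, hδ, hδE⟩ := hsm.exists_norm_smul_add_le (show 0 < a / (4 * max M 1) by positivity)
    have h1 : ∀ᶠ n : ℕ in atTop, max M 1 / δ ≤ n :=
      tendsto_natCast_atTop_atTop.eventually (eventually_ge_atTop _)
    have h2 : ∀ᶠ n : ℕ in atTop, 1 / ((n : ℝ) + 1) < a / 4 :=
      (tendsto_one_div_add_atTop_nhds_zero_nat (𝕜 := ℝ)).eventually (gt_mem_nhds (by positivity))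
    filter_upwards [h1, h2] with n hn1 hn2 w hw haw
    have hwM : ‖-w‖ ≤ max M 1 := by rw [norm_neg]; exact hw.trans (le_max_left _ _)
    have hnD : (n : ℝ) ≤ ‖c (i n) - x‖ := by
      rw [← dist_eq_norm, dist_comm]; exact (hir n).le.trans (hid n)
    have h3 := hδE (g n) (e n) (-w) ‖c (i n) - x‖ (hg n) (hen n) (hge n) (hD0 n) (by
      refine hwM.trans ?_
      rw [div_le_iff₀ hδ] at hn1
      nlinarith)
    rw [← hce, map_neg] at h3
    have h4 : a / (4 * max M 1) * ‖-w‖ ≤ a / (4 * max M 1) * max M 1 := by gcongr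
    have h5 : a / (4 * max M 1) * max M 1 = a / 4 := by field_simp
    have h6 := hid' n
    rw [dist_comm, dist_eq_norm] at h6
    rw [mem_ball, dist_comm, dist_eq_norm, ← sub_sub, sub_eq_add_neg]
    linarith
  obtain ⟨ρ, hρ, hρU⟩ := Metric.isOpen_iff.1 hU x hx
  suffices ∃ w : E, ‖w‖ < ρ ∧ ∃ᶠ n in atTop, x + w ∈ ball (c (i n)) (r (i n)) by
    obtain ⟨w, hw, hfr⟩ := this
    refine ⟨x + w, hρU (by rwa [mem_ball, dist_eq_norm, add_sub_cancel_left]), fun hfin => ?_⟩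
    obtain ⟨R, hR⟩ := (hfin.image r).bddAbove
    obtain ⟨n, hn, hRn⟩ := (hfr.and_eventually
      (tendsto_natCast_atTop_atTop.eventually (eventually_ge_atTop R))).exists
    exact absurd (hir n) (not_lt.2 ((hR ⟨_, hn, rfl⟩).trans hRn))
  by_cases hcase : ∃ w : E, ∃ a > 0, ∃ᶠ n in atTop, a ≤ g n w
  · obtain ⟨w, a, ha, hfr⟩ := hcase
    have hk : 0 < ρ / (‖w‖ + 1) := by positivity
    refine ⟨(ρ / (‖w‖ + 1)) • w, ?_, ?_⟩
    · rw [norm_smul, Real.norm_of_nonneg hk.le, div_mul_eq_mul_div, div_lt_iff₀ (by positivity)]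
      nlinarith
    · refine (hfr.and_eventually (hfact ‖(ρ / (‖w‖ + 1)) • w‖ (ρ / (‖w‖ + 1) * a) (by positivity))).mono ?_
      rintro n ⟨h1, h2⟩
      refine h2 _ le_rfl ?_
      rw [map_smul, smul_eq_mul]
      gcongr
  -- Now `g n` tends to zero pointwise, so a small multiple of `e n` moves any point into the `n`-th
  -- ball. The tail unions are therefore dense, and Baire's theorem applies.
  · push Not at hcase
    let A : ℕ → Set E := fun N => ⋃ n ≥ N, {w | x + w ∈ ball (c (i n)) (r (i n))}
    have hAo (N) : IsOpen (A N) := isOpen_biUnion fun n _ =>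
      isOpen_ball.preimage (continuous_const.add continuous_id)
    have hAd (N) : Dense (A N) := by
      rw [Metric.dense_iff]
      intro w η hη
      have h1 := hcase (-w) (η / 4) (by positivity)
      obtain ⟨n, hn1, hn2, hnN⟩ := (h1.and ((hfact (‖w‖ + η) (η / 4) (by positivity)).and
        (eventually_ge_atTop N))).exists
      refine ⟨w + (η / 2) • e n, ?_, mem_iUnion₂.2 ⟨n, hnN, hn2 _ ?_ ?_⟩⟩
      · rw [mem_ball, dist_eq_norm, add_sub_cancel_left, norm_smul, hen, mul_one,
          Real.norm_of_nonneg (by positivity)]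
        linarith
      · refine (norm_add_le _ _).trans ?_
        rw [norm_smul, hen, mul_one, Real.norm_of_nonneg (by positivity)]
        linarith
      · rw [map_neg] at hn1
        rw [map_add, map_smul, hge, smul_eq_mul]
        linarith
    obtain ⟨w, hw, hwA⟩ := (Metric.dense_iff.1 (dense_iInter_of_isOpen_nat hAo hAd)) 0 ρ hρ
    refine ⟨w, by simpa using hw, frequently_atTop.2 fun N => ?_⟩
    obtain ⟨n, hnN, hn⟩ := mem_iUnion₂.1 (mem_iInter.1 hwA N)
    exact ⟨n, hnN, hn⟩

variable [UniformConvexSpace E] [CompleteSpace E]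

/-- Near every singular point there is a singular point which lies in a ball of the cover that does
not contain the given one. -/
lemma IsTightConvexCover.exists_mem_singularPoints_near (hsm : UniformlySmooth E)
    (hinf : ¬ FiniteDimensional ℝ E) {U : Set E} (hU : IsOpen U) {C : ι → Set E}
    (hC : IsTightConvexCover U C) {c : ι → E} {r : ι → ℝ}
    (hCi : ∀ i, C i ⊆ closedBall (c i) (r i)) (hCU : ∀ i, U ∩ C i ⊆ ball (c i) (r i))
    (hfin : ∀ x ∈ U, {i | x ∈ ball (c i) (r i)}.Finite) {x : E} (hx : x ∈ singularPoints U C)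
    {ρ : ℝ} (hρ : 0 < ρ) :
    ∃ i, ∃ y ∈ singularPoints U C, x ∉ ball (c i) (r i) ∧ y ∈ ball (c i) (r i) ∧ dist y x ≤ ρ := by
  have hnear (t : ℝ) (ht : 0 < t) : ∃ i, x ∉ ball (c i) (r i) ∧ (C i ∩ ball x t).Nonempty := by
    obtain ⟨i, hi, hi'⟩ := ((hx.2 t ht).sdiff (hfin x hx.1)).nonempty
    exact ⟨i, hi', hi⟩
  -- With bounded radii, a ball that omits `x` but has a member of the cover close to `x` has a
  -- small cap there. Otherwise the radii tend to infinity, which point-finiteness excludes.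
  by_cases hR : ∃ R, ∀ t > 0, ∃ i, x ∉ ball (c i) (r i) ∧ (C i ∩ ball x t).Nonempty ∧ r i ≤ R
  · obtain ⟨R, hR⟩ := hR
    obtain ⟨ρ₁, hρ₁, hρ₁U⟩ := Metric.isOpen_iff.1 hU x hx.1
    obtain ⟨ρ', hρ', hρ'ρ, hρ'ρ₁⟩ : ∃ ρ', 0 < ρ' ∧ ρ' ≤ ρ ∧ ρ' < ρ₁ :=
      ⟨min ρ ρ₁ / 2, by positivity, by linarith [min_le_left ρ ρ₁], by
        linarith [min_le_right ρ ρ₁]⟩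
    obtain ⟨t, ht, hcap⟩ := exists_cap_subset (E := E) (R + 1) hρ'
    -- The bound `1` keeps `‖x - c i‖ ≤ R + 1`, as the choice of the cap depth `t` requires.
    obtain ⟨i, hxi, ⟨q, hqC, hqx⟩, hri⟩ := hR (min t 1) (by positivity)
    rw [mem_ball, not_lt, dist_eq_norm] at hxi
    rw [mem_ball] at hqx
    have hr0 : 0 < r i := by
      have hne : (U \ ⋃ j ≠ i, C j).Nonempty := by
        by_contra hemp
        rw [hC.hull, not_nonempty_iff_eq_empty.1 hemp] at hqC
        simpa using closedConvexHull_min (empty_subset _) convex_empty isClosed_empty hqC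
      obtain ⟨v, hv⟩ := hne
      exact pos_of_mem_ball (hCU i ⟨hv.1, hC.diff_subset i hv⟩)
    have hD0 : 0 < ‖x - c i‖ := hr0.trans_le hxi
    have hDR : ‖x - c i‖ ≤ R + 1 := by
      rw [← dist_eq_norm]
      have h1 : dist q (c i) ≤ r i := hCi i hqC
      linarith [dist_triangle_left x (c i) q, min_le_right t 1]
    obtain ⟨g, hg, hgx⟩ := exists_dual_vector_real (x - c i)
    have hsmall (w : E) (hw : w ∈ closedBall (c i) (r i)) (hgw : g x - min t 1 ≤ g w) :
        dist w x ≤ ρ' := by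
      have := hcap g (w - c i) (x - c i) hg hDR hgx (by
        rw [← dist_eq_norm]; exact (mem_closedBall.1 hw).trans hxi) (by
        rw [← hgx, map_sub, map_sub]; linarith [min_le_left t 1])
      rwa [sub_sub_sub_cancel_right, ← dist_eq_norm] at this
    obtain ⟨y, hyS, hyC, hgy⟩ := hC.exists_mem_singularPoints hsm hinf hU (hCi i) hg
      (norm_inv_smul_self hD0) (by rw [map_smul, hgx, smul_eq_mul, inv_mul_cancel₀ hD0.ne']) hqC
      (b := g x - min t 1) (by
        have := StrongDual.apply_le_norm_of_norm_le_one hg (x - q)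
        rw [map_sub, ← dist_eq_norm, dist_comm] at this
        linarith)
      (fun w hw hgw => hρ₁U (mem_ball.2 ((hsmall w hw hgw).trans_lt hρ'ρ₁)))
    exact ⟨i, y, hyS, by rw [mem_ball, not_lt, dist_eq_norm]; exact hxi, hCU i ⟨hyS.1, hyC⟩,
      (hsmall y (hCi i hyC) hgy).trans hρ'ρ⟩
  · push Not at hR
    exfalso
    obtain ⟨y, hyU, hy⟩ := hsm.exists_infinite_mem_ball hU hx.1 (c := c) (r := r) fun n => by
      obtain ⟨t, ht, htR⟩ := hR n
      obtain ⟨i, hxi, hi⟩ := hnear (min t (1 / ((n : ℝ) + 1))) (by positivity)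
      refine ⟨i, htR i hxi (hi.mono (inter_subset_inter_right _
        (ball_subset_ball (min_le_left _ _)))), not_lt.1 hxi, ?_⟩
      obtain ⟨q, hqC, hqx⟩ := hi
      rw [mem_ball] at hqx
      have h1 : dist q (c i) ≤ r i := hCi i hqC
      linarith [dist_triangle_left x (c i) q, min_le_right t (1 / ((n : ℝ) + 1))]
    exact hy (hfin y hyU)

/-- A tight convex cover subordinate to a point-finite family of balls has no singular points. -/
lemma IsTightConvexCover.singularPoints_eq_empty (hsm : UniformlySmooth E)
    (hinf : ¬ FiniteDimensional ℝ E) {U : Set E} (hU : IsOpen U) {C : ι → Set E}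
    (hC : IsTightConvexCover U C) {c : ι → E} {r : ι → ℝ}
    (hCi : ∀ i, C i ⊆ closedBall (c i) (r i)) (hCU : ∀ i, U ∩ C i ⊆ ball (c i) (r i))
    (hfin : ∀ x ∈ U, {i | x ∈ ball (c i) (r i)}.Finite) : singularPoints U C = ∅ := by
  by_contra hne
  obtain ⟨x₀, hx₀⟩ := nonempty_iff_ne_empty.2 hne
  obtain ⟨ρ₀, hρ₀, hρ₀U⟩ := Metric.nhds_basis_closedBall.mem_iff.1 (hU.mem_nhds hx₀.1)
  let T := {a : E × ℝ // a.1 ∈ singularPoints U C ∧ 0 < a.2}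
  have hstep (a : T) : ∃ b : T, ∃ i, a.1.1 ∉ ball (c i) (r i) ∧
      closedBall b.1.1 b.1.2 ⊆ ball (c i) (r i) ∧ dist b.1.1 a.1.1 ≤ a.1.2 / 2 ∧
      b.1.2 ≤ a.1.2 / 2 := by
    obtain ⟨i, y, hyS, hxi, hyi, hyx⟩ := hC.exists_mem_singularPoints_near hsm hinf hU hCi hCU hfin
      a.2.1 (half_pos a.2.2)
    obtain ⟨ρ, hρ, hρB⟩ := Metric.nhds_basis_closedBall.mem_iff.1 (isOpen_ball.mem_nhds hyi)
    exact ⟨⟨(y, min ρ (a.1.2 / 2)), hyS, lt_min hρ (half_pos a.2.2)⟩, i, hxi,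
      (closedBall_subset_closedBall (min_le_left _ _)).trans hρB, hyx, min_le_right _ _⟩
  choose next idx h1 h2 h3 h4 using hstep
  let a : ℕ → T := fun n => next^[n] ⟨(x₀, ρ₀), hx₀, hρ₀⟩
  have ha (n) : a (n + 1) = next (a n) := Function.iterate_succ_apply' _ _ _
  let B : ℕ → Set E := fun n => closedBall (a n).1.1 (a n).1.2
  have hBsub (n) : B (n + 1) ⊆ B n := by
    refine closedBall_subset_closedBall' ?_
    rw [ha]
    linarith [h3 (a n), h4 (a n)]
  have hBanti : Antitone B := antitone_nat_of_succ_le hBsub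
  have hρ (n) : (a n).1.2 ≤ ρ₀ / 2 ^ n := by
    induction n with
    | zero => simp [a]
    | succ n ih =>
      rw [ha, pow_succ, ← div_div]
      linarith [h4 (a n)]
  have hcau : CauchySeq fun n => (a n).1.1 := by
    refine cauchySeq_of_le_geometric_two (C := ρ₀) fun n => ?_
    rw [dist_comm]
    show dist (a (n + 1)).1.1 (a n).1.1 ≤ ρ₀ / 2 / 2 ^ n
    rw [ha, div_right_comm]
    linarith [h3 (a n), hρ n]
  obtain ⟨z, hz⟩ := cauchySeq_tendsto_of_complete hcau
  have hzB (n) : z ∈ B n := by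
    refine isClosed_closedBall.mem_of_tendsto hz (eventually_atTop.2 ⟨n, fun m hm => ?_⟩)
    exact hBanti hm (mem_closedBall_self (a m).2.2.le)
  -- The ball chosen at stage `m` contains all later centres, whereas the one chosen at stage `n`
  -- omits the `n`-th centre.
  have hidx {m n : ℕ} (hmn : m < n) : idx (a m) ≠ idx (a n) := by
    intro heq
    refine h1 (a n) (heq ▸ h2 (a m) ?_)
    rw [← ha]
    exact hBanti (Nat.succ_le_of_lt hmn) (mem_closedBall_self (a n).2.2.le)
  have hinj : Function.Injective fun n => idx (a n) := by
    intro m n hmn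
    rcases lt_trichotomy m n with h | h | h
    exacts [absurd hmn (hidx h), h, absurd hmn.symm (hidx h)]
  refine (infinite_range_of_injective hinj) ((hfin z (hρ₀U (hzB 0))).subset ?_)
  rintro _ ⟨n, rfl⟩
  have := hzB (n + 1)
  exact h2 (a n) (by rw [← ha]; exact this)

/-- An open set admits no point-finite cover by open balls if each ball containing a certain point
has a cap around that point which lies in the open set. -/
theorem not_pointFinite_ball_cover (hsm : UniformlySmooth E) (hinf : ¬ FiniteDimensional ℝ E)
    {U : Set E} (hU : IsOpen U) {c : ι → E} {r : ι → ℝ} (hcov : U ⊆ ⋃ i, ball (c i) (r i))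
    (hfin : ∀ x ∈ U, {i | x ∈ ball (c i) (r i)}.Finite) {x : E} (hx : x ∈ U)
    (hcap : ∀ i, x ∈ ball (c i) (r i) → ∃ (g : StrongDual ℝ E) (u : E) (b : ℝ), ‖g‖ ≤ 1 ∧
      ‖u‖ = 1 ∧ g u = 1 ∧ b < g x ∧ ∀ w ∈ closedBall (c i) (r i), b ≤ g w → w ∈ U) : False := by
  obtain ⟨C, hC, hCi, hCU⟩ := exists_isTightConvexCover_of_ball hcov hfin
  obtain ⟨i, hi⟩ := mem_iUnion.1 (hC.cover hx)
  obtain ⟨g, u, b, hg, hu, hgu, hbx, hw⟩ := hcap i (hCU i ⟨hx, hi⟩)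
  obtain ⟨y, hy, -⟩ := hC.exists_mem_singularPoints hsm hinf hU (hCi i) hg hu hgu hi hbx hw
  rw [hC.singularPoints_eq_empty hsm hinf hU hCi hCU hfin] at hy
  exact hy

end LocallyOpenCover

/-! ### Covers of the whole space: open balls, then countably many closed balls. -/

section Covers

variable {E : Type u} [NormedAddCommGroup E] [NormedSpace ℝ E]

/-- The case `z = 0` is needed: closed balls of radius zero are allowed below, and there the contact
point is the centre. -/
lemma exists_norming_pair [Nontrivial E] (z : E) :
    ∃ (g : StrongDual ℝ E) (u : E), ‖g‖ ≤ 1 ∧ ‖u‖ = 1 ∧ g u = 1 ∧ z = ‖z‖ • u := by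
  obtain ⟨u, hu, hzu⟩ : ∃ u : E, ‖u‖ = 1 ∧ z = ‖z‖ • u := by
    rcases eq_or_ne z 0 with rfl | hz
    · obtain ⟨v, hv⟩ := exists_ne (0 : E)
      exact ⟨‖v‖⁻¹ • v, norm_inv_smul_self (norm_pos_iff.2 hv), by simp⟩
    · have hz' := norm_pos_iff.2 hz
      exact ⟨‖z‖⁻¹ • z, norm_inv_smul_self hz', by
        rw [smul_smul, mul_inv_cancel₀ hz'.ne', one_smul]⟩
  obtain ⟨g, hg, hgu⟩ := exists_dual_vector_real u
  exact ⟨g, u, hg, hu, hgu.trans hu, hzu⟩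

lemma nontrivial_of_not_finiteDimensional (hinf : ¬ FiniteDimensional ℝ E) : Nontrivial E := by
  by_contra h
  rw [not_nontrivial_iff_subsingleton] at h
  exact hinf inferInstance

/-- An infinite-dimensional uniformly convex and uniformly smooth Banach space has no point-finite
cover by open balls. -/
theorem not_pointFinite_ball_cover_univ [UniformConvexSpace E] [CompleteSpace E]
    (hsm : UniformlySmooth E) (hinf : ¬ FiniteDimensional ℝ E) {ι : Type*} {c : ι → E} {r : ι → ℝ}
    (hcov : ⋃ i, ball (c i) (r i) = univ) (hfin : ∀ x, {i | x ∈ ball (c i) (r i)}.Finite) :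
    False := by
  have := nontrivial_of_not_finiteDimensional hinf
  obtain ⟨g, u, hg, hu, hgu, -⟩ := exists_norming_pair (0 : E)
  exact not_pointFinite_ball_cover hsm hinf isOpen_univ hcov.ge (fun x _ => hfin x) (mem_univ 0)
    fun i _ => ⟨g, u, g 0 - 1, hg, hu, hgu, by linarith, fun _ _ _ => mem_univ _⟩

/-- In an infinite-dimensional uniformly convex and uniformly smooth Banach space, the interiors of
countably many closed balls covering the space are not point-finite. -/
theorem not_pointFinite_closedBall_cover [UniformConvexSpace E] [CompleteSpace E]
    (hsm : UniformlySmooth E) (hinf : ¬ FiniteDimensional ℝ E) {ι : Type*} [Countable ι] {c : ι → E}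
    {r : ι → ℝ} (hcov : ⋃ i, closedBall (c i) (r i) = univ)
    (hfin : ∀ x, {i | x ∈ ball (c i) (r i)}.Finite) : False := by
  have := nontrivial_of_not_finiteDimensional hinf
  set T : Set E := (⋃ i, ball (c i) (r i))ᶜ with hT
  rcases T.eq_empty_or_nonempty with hemp | hne
  · exact not_pointFinite_ball_cover_univ hsm hinf (compl_empty_iff.1 hemp) hfin
  have hTcl : IsClosed T := (isOpen_iUnion fun i => isOpen_ball).isClosed_compl
  have := hTcl.completeSpace_coe
  have := hne.to_subtype
  -- Baire's theorem in the complete space `T`: near `x`, one closed ball contains all of `T`.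
  obtain ⟨i₀, ⟨x, hxT⟩, hx⟩ := nonempty_interior_of_iUnion_of_closed
    (f := fun i => ((↑) : T → E) ⁻¹' closedBall (c i) (r i))
    (fun i => isClosed_closedBall.preimage continuous_subtype_val)
    (by rw [← preimage_iUnion, hcov, preimage_univ])
  obtain ⟨ρ, hρ, hρT⟩ := Metric.mem_nhds_iff.1 (mem_interior_iff_mem_nhds.1 hx)
  have hTρ (w : E) (hw : w ∈ ball x ρ) (hwT : w ∈ T) : w ∈ closedBall (c i₀) (r i₀) :=
    @hρT ⟨w, hwT⟩ hw
  have hxr : ‖x - c i₀‖ = r i₀ := by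
    rw [← dist_eq_norm]
    refine le_antisymm (hTρ x (mem_ball_self hρ) hxT) (not_lt.1 fun h => hxT ?_)
    exact mem_iUnion.2 ⟨i₀, h⟩
  obtain ⟨g, u, hg, hu, hgu, hxu⟩ := exists_norming_pair (x - c i₀)
  rw [hxr] at hxu
  have hgx : g x = r i₀ + g (c i₀) := by
    have := congrArg g hxu
    rw [map_sub, map_smul, hgu, smul_eq_mul, mul_one] at this
    linarith
  obtain ⟨t, ht, hcap⟩ := exists_cap_subset (E := E) (r i₀ + 1) (show 0 < ρ / 3 by positivity)
  obtain ⟨ε, hε, hεt, hε1, hερ⟩ : ∃ ε, 0 < ε ∧ ε ≤ t / 2 ∧ ε ≤ 1 ∧ ε ≤ ρ / 3 :=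
    ⟨min (t / 2) (min 1 (ρ / 3)), by positivity, min_le_left _ _,
      (min_le_right _ _).trans (min_le_left _ _), (min_le_right _ _).trans (min_le_right _ _)⟩
  have hr0 : 0 ≤ r i₀ := hxr ▸ norm_nonneg _
  -- Index `none` is the ball `i₀` enlarged by `ε`. It absorbs `T` near `x` and is the only ball
  -- containing `x`; its cap around `x` is small enough to fit in `ball x ρ`.
  refine not_pointFinite_ball_cover (ι := Option ι) hsm hinf (isOpen_ball (x := x) (ε := ρ))
    (c := fun o => o.elim (c i₀) c) (r := fun o => o.elim (r i₀ + ε) r) (fun w hw => ?_)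
    (fun w hw => ?_) (mem_ball_self hρ) ?_
  · by_cases hwT : w ∈ T
    · have : w ∈ ball (c i₀) (r i₀ + ε) :=
        closedBall_subset_ball (by linarith) (hTρ w hw hwT)
      exact mem_iUnion.2 ⟨none, this⟩
    · rw [hT, notMem_compl_iff] at hwT
      obtain ⟨i, hi⟩ := mem_iUnion.1 hwT
      exact mem_iUnion.2 ⟨some i, hi⟩
  · refine (((hfin w).image some).insert none).subset fun o ho => ?_
    cases o with
    | none => exact mem_insert _ _
    | some i => exact mem_insert_of_mem _ ⟨i, ho, rfl⟩
  · rintro (_ | i) hxi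
    · refine ⟨g, u, g x - ε, hg, hu, hgu, by linarith, fun w hw hgw => ?_⟩
      have hn : ‖(r i₀ + ε) • u‖ = r i₀ + ε := by
        rw [norm_smul, hu, mul_one, Real.norm_of_nonneg (by positivity)]
      have h1 := hcap g (w - c i₀) ((r i₀ + ε) • u) hg (by rw [hn]; linarith)
        (by rw [hn, map_smul, hgu, smul_eq_mul, mul_one])
        (by rw [hn, ← dist_eq_norm]; exact hw) (by rw [hn, map_sub]; linarith)
      have h2 : w - x = (w - c i₀ - (r i₀ + ε) • u) + ε • u := by
        rw [add_smul, ← hxu]; abel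
      rw [mem_ball, dist_eq_norm, h2]
      refine (norm_add_le _ _).trans_lt ?_
      rw [norm_smul, hu, mul_one, Real.norm_of_nonneg hε.le]
      linarith
    · exact absurd (mem_iUnion.2 ⟨i, hxi⟩) hxT

end Covers

/-! ### Reduction to a separable subspace. -/

section SeparableReduction

variable {E : Type u} [NormedAddCommGroup E] [NormedSpace ℝ E]

lemma UniformlySmooth.submodule (h : UniformlySmooth E) (Y : Submodule ℝ E) :
    UniformlySmooth Y := fun ε hε => by
  obtain ⟨δ, hδ, hE⟩ := h ε hε
  exact ⟨δ, hδ, fun x y hx hy => hE x y hx hy⟩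

lemma UniformConvexSpace.submodule [UniformConvexSpace E] (Y : Submodule ℝ E) :
    UniformConvexSpace Y := ⟨fun ε hε => by
  obtain ⟨δ, hδ, hE⟩ := UniformConvexSpace.uniform_convex (E := E) hε
  exact ⟨δ, hδ, fun x hx y hy hxy => hE hx hy hxy⟩⟩

/-- Only countably many members of a point-finite family of open sets meet a separable set. -/
lemma countable_setOf_inter_nonempty {X ι : Type*} [TopologicalSpace X] [PseudoMetrizableSpace X]
    {B : ι → Set X} (hB : ∀ i, IsOpen (B i)) (hfin : ∀ x, {i | x ∈ B i}.Finite) {Z : Set X}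
    (hZ : IsSeparable Z) : {i | (B i ∩ Z).Nonempty}.Countable := by
  obtain ⟨t, -, htc, hZt⟩ := hZ.exists_countable_dense_subset
  refine (htc.biUnion fun d _ => (hfin d).countable).mono ?_
  rintro i ⟨z, hzB, hzZ⟩
  obtain ⟨d, hdB, hdt⟩ := mem_closure_iff.1 (hZt hzZ) _ (hB i) hzB
  exact mem_iUnion₂.2 ⟨d, hdt, hdB⟩

/-- For a point-finite family of open balls of an infinite-dimensional space there is a separable
closed infinite-dimensional subspace containing the center of each ball that it meets. -/
lemma exists_separable_subspace_of_pointFinite (hinf : ¬ FiniteDimensional ℝ E) {ι : Type*}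
    {c : ι → E} {r : ι → ℝ} (hfin : ∀ x, {i | x ∈ ball (c i) (r i)}.Finite) :
    ∃ Y : Submodule ℝ E, IsClosed (Y : Set E) ∧ IsSeparable (Y : Set E) ∧
      ¬ FiniteDimensional ℝ Y ∧ ∀ i, (ball (c i) (r i) ∩ (Y : Set E)).Nonempty → c i ∈ Y := by
  obtain ⟨v, hv⟩ : ∃ v : ℕ → E, LinearIndependent ℝ v := by
    let b := Module.Basis.ofVectorSpace ℝ E
    have : Infinite (Module.Basis.ofVectorSpaceIndex ℝ E) := by
      by_contra h
      rw [not_infinite_iff_finite] at h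
      exact hinf (Module.Finite.of_basis b)
    exact ⟨_, b.linearIndependent.comp _ (Infinite.natEmbedding _).injective⟩
  -- Adding centres creates new intersections, so the step is iterated. Since the balls are open,
  -- one meeting the closure of the union already meets some `Z n`.
  let next : Submodule ℝ E → Submodule ℝ E := fun Z =>
    Submodule.span ℝ (Z ∪ c '' {i | (ball (c i) (r i) ∩ (Z : Set E)).Nonempty})
  let Z : ℕ → Submodule ℝ E := fun n => next^[n] (Submodule.span ℝ (range v))
  have hZ (n) : Z (n + 1) = next (Z n) := Function.iterate_succ_apply' _ _ _
  have hmono : Monotone Z := monotone_nat_of_le_succ fun n => by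
    rw [hZ]
    exact fun x hx => Submodule.subset_span (Or.inl hx)
  have hsep (n) : IsSeparable (Z n : Set E) := by
    induction n with
    | zero => exact (countable_range v).isSeparable.span
    | succ n ih =>
      rw [hZ]
      exact (ih.union ((countable_setOf_inter_nonempty (fun _ => isOpen_ball) hfin
        ih).image c).isSeparable).span
  have hsup : ((⨆ n, Z n : Submodule ℝ E) : Set E) = ⋃ n, (Z n : Set E) :=
    Submodule.coe_iSup_of_directed _ hmono.directed_le
  have hle : (⨆ n, Z n) ≤ (⨆ n, Z n).topologicalClosure := Submodule.le_topologicalClosure _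
  refine ⟨(⨆ n, Z n).topologicalClosure, Submodule.isClosed_topologicalClosure _, ?_, ?_, ?_⟩
  · rw [Submodule.topologicalClosure_coe, hsup]
    exact (IsSeparable.iUnion hsep).closure
  · intro hfd
    have hvY (n) : v n ∈ (⨆ n, Z n).topologicalClosure :=
      hle ((le_iSup Z 0) (Submodule.subset_span ⟨n, rfl⟩))
    have : LinearIndependent ℝ fun n => (⟨v n, hvY n⟩ : (⨆ n, Z n).topologicalClosure) :=
      LinearIndependent.of_comp (Submodule.subtype _) hv
    exact not_finite_iff_infinite.2 inferInstance this.finite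
  · rintro i ⟨y, hyB, hyY⟩
    rw [SetLike.mem_coe, ← SetLike.mem_coe, Submodule.topologicalClosure_coe] at hyY
    obtain ⟨z, hzB, hz⟩ := mem_closure_iff.1 hyY _ isOpen_ball hyB
    rw [hsup] at hz
    obtain ⟨n, hn⟩ := mem_iUnion.1 hz
    refine hle ((le_iSup Z (n + 1)) ?_)
    rw [hZ]
    exact Submodule.subset_span (Or.inr ⟨i, ⟨z, hzB, hn⟩, rfl⟩)

/-- A measurable subset of a standard Borel space of cardinality less than the continuum is
countable. -/
lemma MeasurableSet.countable_of_mk_lt_continuum {α : Type u} [MeasurableSpace α]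
    [StandardBorelSpace α] {Q : Set α} (hQ : MeasurableSet Q) (h : #Q < 𝔠) : Countable Q := by
  by_contra hnc
  have := hQ.standardBorel
  have e : Q ≃ᵐ ℝ := PolishSpace.measurableEquivOfNotCountable hnc
    (fun hc => Cardinal.not_countable_real (Set.countable_univ_iff.2 hc))
  have h1 := Cardinal.lift_mk_eq'.2 ⟨e.toEquiv⟩
  rw [Cardinal.mk_real, Cardinal.lift_continuum] at h1
  rw [← Cardinal.lift_lt.{u, 0}, h1, Cardinal.lift_continuum] at h
  exact lt_irrefl _ h

/-- An infinite-dimensional uniformly convex and uniformly smooth Banach space is not covered by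
fewer than continuum many closed balls whose interiors are point-finite. -/
theorem not_pointFinite_closedBall_cover_of_mk_lt_continuum [UniformConvexSpace E] [CompleteSpace E]
    (hsm : UniformlySmooth E) (hinf : ¬ FiniteDimensional ℝ E) {ι : Type u} (hι : #ι < 𝔠)
    {c : ι → E} {r : ι → ℝ} (hcov : ⋃ i, closedBall (c i) (r i) = univ)
    (hfin : ∀ x, {i | x ∈ ball (c i) (r i)}.Finite) : False := by
  obtain ⟨Y, hYcl, hYsep, hYinf, hYc⟩ := exists_separable_subspace_of_pointFinite hinf hfin
  have := hYcl.completeSpace_coe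
  have := hYsep.separableSpace
  have := UniformConvexSpace.submodule Y
  let ι' := {i // (ball (c i) (r i) ∩ (Y : Set E)).Nonempty}
  have : Countable ι' :=
    (countable_setOf_inter_nonempty (fun _ => isOpen_ball) hfin hYsep).to_subtype
  borelize ↥Y
  let Q : Set Y := (⋃ i : ι', ((↑) : Y → E) ⁻¹' closedBall (c i) (r i))ᶜ
  have hQm : MeasurableSet Q := (MeasurableSet.iUnion fun i : ι' =>
    (isClosed_closedBall.preimage continuous_subtype_val).measurableSet).compl
  have hQι : #Q ≤ #ι := by
    have hex (y : Q) : ∃ i, ((y : Y) : E) ∈ closedBall (c i) (r i) :=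
      mem_iUnion.1 (hcov ▸ mem_univ _)
    choose f hf using hex
    refine Cardinal.mk_le_of_injective (f := f) fun y y' hyy' => ?_
    by_contra hne
    have hne' : ((y : Y) : E) ≠ ((y' : Y) : E) := fun h => hne (Subtype.ext (Subtype.ext h))
    -- By strict convexity the midpoint lies in the open ball, and also in `Y`; so this ball is
    -- indexed by `ι'` and covers `y`, contrary to `y ∈ Q`.
    have hmid := combo_mem_ball_of_ne (hf y) (hyy' ▸ hf y') hne' one_half_pos one_half_pos
      (add_halves 1)
    refine y.2 (mem_iUnion.2 ⟨⟨f y, _, hmid, ?_⟩, hf y⟩)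
    exact Y.add_mem (Y.smul_mem _ (y : Y).2) (Y.smul_mem _ (y' : Y).2)
  have : Countable Q := hQm.countable_of_mk_lt_continuum (hQι.trans_lt hι)
  -- The points of `Q` enter as closed balls of radius zero, whose open balls are empty and do not
  -- affect point-finiteness.
  refine not_pointFinite_closedBall_cover (ι := ι' ⊕ Q) (hsm.submodule Y) hYinf
    (c := Sum.elim (fun i => ⟨c i, hYc i i.2⟩) (fun q => q)) (r := Sum.elim (fun i => r i) fun _ => 0)
    (eq_univ_of_forall fun y => ?_) fun y => ?_
  · by_cases hy : y ∈ Q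
    · exact mem_iUnion.2 ⟨Sum.inr ⟨y, hy⟩, by simp⟩
    · rw [notMem_compl_iff] at hy
      obtain ⟨i, hi⟩ := mem_iUnion.1 hy
      exact mem_iUnion.2 ⟨Sum.inl i, hi⟩
  · have h1 : {i : ι' | (y : E) ∈ ball (c i) (r i)}.Finite :=
      (hfin y).preimage Subtype.val_injective.injOn
    refine (h1.image Sum.inl).subset ?_
    rintro (i | q) hk
    · exact ⟨i, hk, rfl⟩
    · exact absurd (show dist y q < 0 from hk) dist_nonneg.not_gt

end SeparableReduction

/-! ### Counting the balls, and conclusion. -/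

/-- A point-finite family of sets with nonempty interior has fewer than continuum many members if
the density character is less than the continuum. -/
lemma mk_lt_continuum_of_densityCharacter_lt {T : Type u} [TopologicalSpace T]
    (h : densityCharacter T < 𝔠) {F : Set (Set T)} (hF : ∀ A ∈ F, (interior A).Nonempty)
    (hfin : IsPointFinite F) : #F < 𝔠 := by
  obtain ⟨D, hD, hDT⟩ : densityCharacter T ∈ {κ : Cardinal.{u} | ∃ D : Set T, Dense D ∧ #D = κ} :=
    csInf_mem ⟨_, univ, dense_univ, rfl⟩
  have hex (A : F) : ∃ d ∈ D, d ∈ (A : Set T) := by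
    obtain ⟨d, hd, hdD⟩ := hD.inter_open_nonempty _ isOpen_interior (hF A A.2)
    exact ⟨d, hdD, interior_subset hd⟩
  choose f hfD hf using hex
  have hle : #F ≤ #D * ℵ₀ := by
    refine Cardinal.mk_le_mk_mul_of_mk_preimage_le (fun A => (⟨f A, hfD A⟩ : D)) fun d => ?_
    have : {A : F | (d : T) ∈ (A : Set T)}.Finite :=
      Set.Finite.of_finite_image ((hfin d).subset (by rintro _ ⟨A, hA, rfl⟩; exact ⟨A.2, hA⟩))
        Subtype.val_injective.injOn
    refine Cardinal.mk_le_aleph0_iff.2 (this.subset fun A hA => ?_).countable.to_subtype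
    have : (⟨f A, hfD A⟩ : D) = d := hA
    exact this ▸ hf A
  exact hle.trans_lt (Cardinal.mul_lt_of_lt Cardinal.aleph0_le_continuum (hDT ▸ h)
    Cardinal.aleph0_lt_continuum)

theorem mainTheorem3 (X : Type u) [NormedAddCommGroup X] [NormedSpace ℝ X] [CompleteSpace X]
    (hinf : ¬ FiniteDimensional ℝ X) (hrot : UniformConvexSpace X) (hsm : UniformlySmooth X) :
    (densityCharacter X < Cardinal.continuum.{u} →
      ¬ ∃ F : Set (Set X), (∀ A ∈ F, IsOpenBall A ∨ IsClosedBallOfPosRadius A) ∧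
        IsCovering F ∧ IsPointFinite F) ∧
    (∀ F : Set (Set X), (∀ A ∈ F, IsOpenBall A) → IsCovering F → ¬ IsPointFinite F) := by
  have index_finite {F : Set (Set X)} (hfin : IsPointFinite F) (x : X) :
      {A : F | x ∈ (A : Set X)}.Finite :=
    Set.Finite.of_finite_image ((hfin x).subset (by rintro _ ⟨A, hA, rfl⟩; exact ⟨A.2, hA⟩))
      Subtype.val_injective.injOn
  refine ⟨?_, fun F hF hcov hfin => ?_⟩
  · rintro hdens ⟨F, hF, hcov, hfin⟩
    -- This sandwich is all that is used of the mixed family: the closed balls cover, and the open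
    -- balls inherit point-finiteness.
    have hex (A : F) : ∃ (c : X) (r : ℝ), 0 < r ∧ ball c r ⊆ A ∧ (A : Set X) ⊆ closedBall c r := by
      rcases hF A A.2 with ⟨c, r, hr, h⟩ | ⟨c, r, hr, h⟩
      · exact ⟨c, r, hr, h.ge, h.trans_subset ball_subset_closedBall⟩
      · exact ⟨c, r, hr, ball_subset_closedBall.trans h.ge, h.le⟩
    choose c r hr hball hclosed using hex
    refine not_pointFinite_closedBall_cover_of_mk_lt_continuum hsm hinf
      (mk_lt_continuum_of_densityCharacter_lt hdens (fun A hA => ?_) hfin) (c := c) (r := r)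
      (eq_univ_of_forall fun x => ?_)
      fun x => (index_finite hfin x).subset fun A hA => hball A hA
    · exact ⟨c ⟨A, hA⟩, mem_interior.2 ⟨_, hball ⟨A, hA⟩, isOpen_ball, mem_ball_self (hr _)⟩⟩
    · obtain ⟨A, hA, hx⟩ := mem_sUnion.1 (hcov.ge (mem_univ x))
      exact mem_iUnion.2 ⟨⟨A, hA⟩, hclosed _ hx⟩
  · choose c r hr hball using fun A : F => hF A A.2
    refine not_pointFinite_ball_cover_univ hsm hinf (c := c) (r := r)
      (eq_univ_of_forall fun x => ?_)
      fun x => (index_finite hfin x).subset fun A hA => by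
        rw [mem_ofPred_eq, hball A]; exact hA
    obtain ⟨A, hA, hx⟩ := mem_sUnion.1 (hcov.ge (mem_univ x))
    exact mem_iUnion.2 ⟨⟨A, hA⟩, hball ⟨A, hA⟩ ▸ hx⟩
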